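/- Conventions. Categories are locally small, and "small" refers to sets as opposed to proper classes. A functor $X\colon \mathcal A^{\mathrm{op}}\to\mathbf{Set}$ (or $Y\colon\mathcal A\to\mathbf{Set}$) is small if it is a small colimit of representables. The conjugate of a small $X\colon\mathcal A^{\mathrm{op}}\to\mathbf{Set}$ is $X^\vee\colon\mathcal A\to\mathbf{Set}$, $X^\vee(a)=\mathrm{Nat}(X,\mathcal A(-,a))$, and that of a small $Y\colon\mathcal A\to\mathbf{Set}$ is $Y^\vee\colon\mathcal A^{\mathrm{op}}\to\mathbf{Set}$, $Y^\vee(a)=\mathrm{Nat}(Y,\mathcal A(a,-))$. The functor $X\colon\mathcal A^{\mathrm{op}}\to\mathbf{Set}$ is reflexive if $X$ and $X^\vee$ are small and the evaluation map $\eta_X\colon X\to X^{\vee\vee}$, $\eta_{X,a}(x)=(\xi\mapsto\xi_a(x))$, is an isomorphism. The reflexive completion $\mathcal R(\mathcal A)$ is the category of reflexive functors $\mathcal A^{\mathrm{op}}\to\mathbf{Set}$ and natural transformations, and $J_{\mathcal A}\colon\mathcal A\to\mathcal R(\mathcal A)$, $a\mapsto\mathcal A(-,a)$, is the Yoneda embedding.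 A functor $F\colon\mathcal A\to\mathcal B$ is dense if $\mathcal B\to[\mathcal A^{\mathrm{op}},\mathbf{Set}]$, $b\mapsto\mathcal B(F-,b)$, is full and faithful, and codense if $\mathcal B\to[\mathcal A,\mathbf{Set}]^{\mathrm{op}}$, $b\mapsto\mathcal B(b,F-)$, is full and faithful. It is adequate if it is full, faithful, dense and codense, and small-adequate if moreover all the functors $\mathcal B(F-,b)$ and $\mathcal B(b,F-)$ $(b\in\mathcal B)$ are small. Theorem. Let $F\colon\mathcal A\to\mathcal B$ be a small-adequate functor. Then: 1. Every functor $\mathcal B(F-,b)$ is reflexive, and the resulting functor $N_F\colon\mathcal B\to\mathcal R(\mathcal A)$, $b\mapsto\mathcal B(F-,b)$, is adequate. 2. The triangle commutes up to canonical isomorphism: there is an isomorphism $\varepsilon\colon J_{\mathcal A}\cong N_F\circ F$ whose components are the maps $\mathcal A(a',a)\to\mathcal B(Fa',Fa)$, $f\mapsto Ff$. 3. Up to isomorphism, $N_F$ is the unique full and faithful functor making the triangle commute. More precisely, for every full and faithful functor $G\colon\mathcal B\to\mathcal R(\mathcal A)$ and every isomorphism $\varphi\colon J_{\mathcal A}\cong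 G\circ F$, there is exactly one natural transformation $\theta\colon G\to N_F$ with $\theta F\circ\varphi=\varepsilon$, and $\theta$ is an isomorphism. 4. $J_{\mathcal A}\colon\mathcal A\to\mathcal R(\mathcal A)$ is itself small-adequate. Thus $J_{\mathcal A}\colon\mathcal A\to\mathcal R(\mathcal A)$ is terminal, in the 2-categorical sense, among small-adequate functors out of $\mathcal A$, where a map from $F\colon\mathcal A\to\mathcal B$ to $F'\colon\mathcal A\to\mathcal B'$ is an adequate functor $G\colon\mathcal B\to\mathcal B'$ with an isomorphism $F'\cong G\circ F$, and 2-cells are the natural transformations compatible with these isomorphisms. -/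

import Mathlib

open CategoryTheory Opposite Limits

/-! Size conventions. "Small" means indexed by a type in `Type w`. A locally small category is
modelled by a type of objects in an arbitrary universe, with homs in `Type w` (or, for the
codomain of a functor out of `A`, in `Type (max t w)`, so that `𝓡(A)` itself, whose hom-sets are
natural transformations, is also allowed). Set-valued functors take values in `Type (max t w)`
for a free universe parameter `t`; for `t = 0` or `t = w` this is `Type w`. Raising `t` does not
add new objects: a small functor has `w`-small values, since it is a `Type w`-indexed colimit of
representables. In the same way, a category with a small-dense functor from `A` automatically
has `w`-small hom-sets. -/

universe t w v₁ v₂ u u₁ u₂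

namespace ReflexiveCompletion

section Nerve

variable {A : Type u₁} [Category.{v₁} A] {B : Type u₂} [Category.{v₂} B]

/-- The nerve functor `B ⥤ [Aᵒᵖ, Set]`, `b ↦ B(F -, b)`. -/
def relNerve (F : A ⥤ B) : B ⥤ Aᵒᵖ ⥤ Type v₂ :=
  yoneda ⋙ (Functor.whiskeringLeft _ _ _).obj F.op

/-- The conerve functor `B ⥤ [A, Set]ᵒᵖ`, `b ↦ B(b, F -)`. -/
def relConerve (F : A ⥤ B) : B ⥤ (A ⥤ Type v₂)ᵒᵖ :=
  (coyoneda ⋙ (Functor.whiskeringLeft _ _ _).obj F).rightOp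

/-- `F` is dense if its nerve functor is full and faithful. -/
def IsDense (F : A ⥤ B) : Prop := (relNerve F).Full ∧ (relNerve F).Faithful

/-- `F` is codense if its conerve functor is full and faithful. -/
def IsCodense (F : A ⥤ B) : Prop := (relConerve F).Full ∧ (relConerve F).Faithful

/-- `F` is adequate if it is full, faithful, dense and codense. -/
structure IsAdequate (F : A ⥤ B) : Prop where
  full : F.Full
  faithful : F.Faithful
  dense : IsDense F
  codense : IsCodense F

end Nerve

section Small

variable {A : Type u} [Category.{w} A]

/-- A functor `X : Aᵒᵖ ⥤ Set` is small if it is a small colimit of representables `A(-, a)`. -/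
def IsSmallContra (X : Aᵒᵖ ⥤ Type (max t w)) : Prop :=
  ∃ (I : Type w) (_ : SmallCategory I) (D : I ⥤ A)
    (α : D ⋙ uliftYoneda.{t} ⟶ (Functor.const I).obj X), Nonempty (IsColimit (Cocone.mk X α))

/-- A functor `Y : A ⥤ Set` is small if it is a small colimit of representables `A(a, -)`. -/
def IsSmallCov (Y : A ⥤ Type (max t w)) : Prop :=
  ∃ (I : Type w) (_ : SmallCategory I) (D : I ⥤ Aᵒᵖ)
    (α : D ⋙ uliftCoyoneda.{t} ⟶ (Functor.const I).obj Y), Nonempty (IsColimit (Cocone.mk Y α))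

/-- The conjugate `a ↦ Nat(X, A(-, a))` of `X : Aᵒᵖ ⥤ Set`. -/
def conjContra (X : Aᵒᵖ ⥤ Type (max t w)) : A ⥤ Type (max u t w) :=
  uliftYoneda.{t} ⋙ coyoneda.obj (op X)

/-- The conjugate `a ↦ Nat(Y, A(a, -))` of `Y : A ⥤ Set`. -/
def conjCov (Y : A ⥤ Type (max t w)) : Aᵒᵖ ⥤ Type (max u t w) :=
  uliftCoyoneda.{t} ⋙ coyoneda.obj (op Y)

/-- The canonical map from `X` to its double conjugate: `x ∈ X(a)` is sent to evaluation at `x`,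
i.e. to the transformation with components `Nat(X, A(-, b)) → A(a, b)`, `ξ ↦ ξ_a(x)`.
(`uliftFunctor` only raises the universe of the values of `X`.) -/
def toDoubleConj (X : Aᵒᵖ ⥤ Type (max t w)) :
    X ⋙ uliftFunctor.{u} ⟶ conjCov.{max u t} (conjContra.{t} X) where
  app a := ↾fun x =>
    { app := fun b => ↾fun (ξ : X ⟶ uliftYoneda.{t}.obj b) =>
        (ULift.up (ξ.app a x.down).down : ULift.{max u t} (a.unop ⟶ b))
      naturality := fun b c g => by
        ext ξ
        rfl }
  naturality a a' f := by
    ext x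
    refine NatTrans.ext (funext fun b => ?_)
    ext ξ
    exact congrArg (fun z => ULift.up (ULift.down z)) (NatTrans.naturality_apply
      (show X ⟶ uliftYoneda.{t}.obj b from ξ) f x.down)

/-- `X : Aᵒᵖ ⥤ Set` is reflexive if it is small, its conjugate is small, and the canonical map
to its double conjugate is an isomorphism. -/
structure IsReflexive (X : Aᵒᵖ ⥤ Type (max t w)) : Prop where
  small : IsSmallContra.{t} X
  conj_small : IsSmallCov.{max u t} (conjContra.{t} X)
  isIso_toDoubleConj : IsIso (toDoubleConj.{t} X)

end Small

/-- `F : A ⥤ B` is small-adequate if it is full, faithful, small-dense (dense and every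
`B(F -, b)` is small) and small-codense (codense and every `B(b, F -)` is small). -/
structure IsSmallAdequate {A : Type u₁} [Category.{w} A] {B : Type u₂} [Category.{max t w} B]
    (F : A ⥤ B) : Prop where
  full : F.Full
  faithful : F.Faithful
  dense : IsDense F
  small : ∀ b : B, IsSmallContra.{t} ((relNerve F).obj b)
  codense : IsCodense F
  cosmall : ∀ b : B, IsSmallCov.{t} ((relConerve F).obj b).unop

/-- The reflexive completion of `A`: the category of reflexive functors `Aᵒᵖ ⥤ Set` and all
natural transformations between them. -/
abbrev Refl (A : Type u) [Category.{w} A] :=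
  ObjectProperty.FullSubcategory (fun X : Aᵒᵖ ⥤ Type (max t w) => IsReflexive.{t} X)

section Yoneda

variable {A : Type u} [Category.{w} A]

theorem isSmallContra_of_iso {X : Aᵒᵖ ⥤ Type (max t w)} {a : A}
    (i : uliftYoneda.{t}.obj a ≅ X) : IsSmallContra.{t} X :=
  ⟨Discrete PUnit.{w + 1}, inferInstance, Functor.fromPUnit a,
    { app := fun _ => i.hom
      naturality := by intros; dsimp; simp },
    ⟨{ desc := fun s => i.inv ≫ s.ι.app ⟨⟨⟩⟩
       fac := by rintro s ⟨⟨⟩⟩; simp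
       uniq := by
        intro s m hm
        have := hm ⟨⟨⟩⟩
        simp [← this] }⟩⟩

theorem isSmallCov_of_iso {Y : A ⥤ Type (max t w)} {a : A}
    (i : uliftCoyoneda.{t}.obj (op a) ≅ Y) : IsSmallCov.{t} Y :=
  ⟨Discrete PUnit.{w + 1}, inferInstance, Functor.fromPUnit (op a),
    { app := fun _ => i.hom
      naturality := by intros; dsimp; simp },
    ⟨{ desc := fun s => i.inv ≫ s.ι.app ⟨⟨⟩⟩
       fac := by rintro s ⟨⟨⟩⟩; simp
       uniq := by
        intro s m hm
        have := hm ⟨⟨⟩⟩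
        simp [← this] }⟩⟩

/-- The Yoneda isomorphism between `A(a, -)` and the conjugate of `A(-, a)`. -/
def conjYonedaIso (a : A) :
    uliftCoyoneda.{max u t}.obj (op a) ≅ conjContra.{t} (uliftYoneda.{t}.obj a) :=
  NatIso.ofComponents
    (fun b =>
      { hom := ↾fun f => uliftYoneda.{t}.map f.down
        inv := ↾fun (ξ : uliftYoneda.{t}.obj a ⟶ uliftYoneda.{t}.obj b) =>
          ULift.up (ξ.app (op a) (ULift.up (𝟙 a))).down
        hom_inv_id := by
          ext ⟨f⟩
          exact congrArg ULift.up (Category.id_comp f)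
        inv_hom_id := by
          ext ξ
          refine NatTrans.ext (funext fun c => ?_)
          ext ⟨g⟩
          have h := NatTrans.naturality_apply
            (show uliftYoneda.{t}.obj a ⟶ uliftYoneda.{t}.obj b from ξ) (Quiver.Hom.op g)
            (show (uliftYoneda.{t}.obj a).obj (op a) from ULift.up (𝟙 a))
          refine Eq.trans h.symm (congrArg _ ?_)
          exact congrArg ULift.up (Category.comp_id g) })
    (by
      intro b c g
      ext ⟨f⟩
      exact uliftYoneda.{t}.map_comp f g)

theorem isReflexive_yoneda (a : A) : IsReflexive.{t} (uliftYoneda.{t}.obj a) where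
  small := isSmallContra_of_iso (Iso.refl _)
  conj_small := isSmallCov_of_iso.{max u t} (conjYonedaIso a)
  isIso_toDoubleConj := by
    rw [NatTrans.isIso_iff_isIso_app]
    intro c
    rw [isIso_iff_bijective]
    constructor
    · rintro ⟨⟨f⟩⟩ ⟨⟨g⟩⟩ h
      have h' := ConcreteCategory.congr_hom (NatTrans.congr_app h a) (𝟙 (uliftYoneda.{t}.obj a))
      have h2 : f = g := congrArg ULift.down h'
      rw [h2]
    · intro τ
      refine ⟨⟨⟨(τ.app a (𝟙 (uliftYoneda.{t}.obj a))).down⟩⟩, ?_⟩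
      refine NatTrans.ext (funext fun b => ?_)
      ext ξ
      obtain ⟨⟨f⟩, rfl⟩ : ∃ f, (conjYonedaIso.{t} a).hom.app b f = ξ :=
        ⟨(conjYonedaIso.{t} a).inv.app b ξ,
          ConcreteCategory.congr_hom ((conjYonedaIso.{t} a).inv_hom_id_app b) ξ⟩
      have h := NatTrans.naturality_apply τ f (𝟙 (uliftYoneda.{t}.obj a))
      have h3 : (conjContra.{t} (uliftYoneda.{t}.obj a)).map f (𝟙 (uliftYoneda.{t}.obj a)) =
          (conjYonedaIso.{t} a).hom.app b ⟨f⟩ :=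
        Category.id_comp (uliftYoneda.{t}.map f)
      rw [h3] at h
      exact h.symm

end Yoneda

/-- The Yoneda embedding `A ⥤ 𝓡(A)`, `a ↦ A(-, a)`. -/
def yonedaRefl (A : Type u) [Category.{w} A] : A ⥤ Refl.{t} A :=
  ObjectProperty.lift _ uliftYoneda.{t} isReflexive_yoneda

/-- The nerve functor of `F` regarded as a functor `B ⥤ 𝓡(A)`, `b ↦ B(F -, b)`, when all the
functors `B(F -, b)` are reflexive. -/
def reflNerve {A : Type u₁} [Category.{w} A] {B : Type u₂} [Category.{max t w} B]
    (F : A ⥤ B) (hN : ∀ b : B, IsReflexive.{t} ((relNerve F).obj b)) : B ⥤ Refl.{t} A :=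
  ObjectProperty.lift _ (relNerve F) hN

end ReflexiveCompletion

open ReflexiveCompletion

/-! Write `J` for the Yoneda embedding `A ⥤ 𝓡(A)` and `N` for the nerve of `F`. `J` is dense by the
Yoneda lemma, since `X(a)` is `Hom(J a, X)`. It is codense because of reflexivity, since `X(a)` is
also the set of natural maps from the conjugate of `X` to `A(a, -)`.

If `F` is full, faithful and dense, then `Nat(B(F -, b), A(-, c)) ≅ Nat(B(F -, b), B(F -, F c)) ≅
B(b, F c)`. So the conjugate of `B(F -, b)` is `B(b, F -)` (`conjNerveIso`), and codensity of `F`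
makes the double conjugation map bijective (`IsSmallAdequate.isReflexive`). Density of `F` says that
`N` is full and faithful. Adequacy of `N` is inherited from `J ≅ F ⋙ N` (`IsDense.of_precomp`,
`IsCodense.of_precomp`).

For a full and faithful `G` with `J ≅ F ⋙ G`, Yoneda gives `G(b)(a) ≅ Hom(J a, G b) ≅ Hom(G (F a), G
b) ≅ B(F a, b)`, so `G ≅ N`. Density of `J` makes the comparison unique. -/

namespace ReflexiveCompletion

/-! ### Density and codensity, elementwise and under factorization. -/

section Density

variable {A : Type u₁} [Category.{v₁} A] {B : Type u₂} [Category.{v₂} B]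

theorem isDense_iff (F : A ⥤ B) : IsDense F ↔
    (∀ ⦃b b' : B⦄ (p q : b ⟶ b'), (∀ (a : A) (h : F.obj a ⟶ b), h ≫ p = h ≫ q) → p = q) ∧
    (∀ ⦃b b' : B⦄ (τ : ∀ a : A, (F.obj a ⟶ b) → (F.obj a ⟶ b')),
      (∀ (a a' : A) (f : a' ⟶ a) (h : F.obj a ⟶ b), τ a' (F.map f ≫ h) = F.map f ≫ τ a h) →
      ∃ p : b ⟶ b', ∀ (a : A) (h : F.obj a ⟶ b), τ a h = h ≫ p) := by
  constructor
  · rintro ⟨hfull, hfaith⟩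
    refine ⟨fun b b' p q hpq => hfaith.map_injective ?_, fun b b' τ hτ => ?_⟩
    · refine NatTrans.ext (funext fun a => ?_)
      ext h
      exact hpq _ h
    · let T : (relNerve F).obj b ⟶ (relNerve F).obj b' :=
        { app := fun a => ↾fun h => τ a.unop h
          naturality := fun a a' f => by
            ext h
            exact hτ a.unop a'.unop f.unop h }
      obtain ⟨p, hp⟩ := hfull.map_surjective T
      exact ⟨p, fun a h => (ConcreteCategory.congr_hom (NatTrans.congr_app hp (op a)) h).symm⟩
  · rintro ⟨hfaith, hfull⟩
    refine ⟨⟨fun {b b'} T => ?_⟩, ⟨fun {b b'} p q hpq => hfaith p q fun a h => ?_⟩⟩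
    · obtain ⟨p, hp⟩ := hfull (fun a h => T.app (op a) h)
        (fun a a' f h => NatTrans.naturality_apply T f.op h)
      refine ⟨p, NatTrans.ext (funext fun a => ?_)⟩
      ext h
      exact (hp a.unop h).symm
    · exact ConcreteCategory.congr_hom (NatTrans.congr_app hpq (op a)) h

theorem isCodense_iff (F : A ⥤ B) : IsCodense F ↔
    (∀ ⦃b b' : B⦄ (p q : b ⟶ b'), (∀ (a : A) (h : b' ⟶ F.obj a), p ≫ h = q ≫ h) → p = q) ∧
    (∀ ⦃b b' : B⦄ (τ : ∀ a : A, (b' ⟶ F.obj a) → (b ⟶ F.obj a)),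
      (∀ (a a' : A) (f : a ⟶ a') (h : b' ⟶ F.obj a), τ a' (h ≫ F.map f) = τ a h ≫ F.map f) →
      ∃ p : b ⟶ b', ∀ (a : A) (h : b' ⟶ F.obj a), τ a h = p ≫ h) := by
  constructor
  · rintro ⟨hfull, hfaith⟩
    refine ⟨fun b b' p q hpq => hfaith.map_injective (Quiver.Hom.unop_inj ?_), fun b b' τ hτ => ?_⟩
    · refine NatTrans.ext (funext fun a => ?_)
      ext h
      exact hpq _ h
    · let T : ((relConerve F).obj b').unop ⟶ ((relConerve F).obj b).unop :=
        { app := fun a => ↾fun h => τ a h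
          naturality := fun a a' f => by
            ext h
            exact hτ a a' f h }
      obtain ⟨p, hp⟩ := hfull.map_surjective T.op
      exact ⟨p, fun a h =>
        (ConcreteCategory.congr_hom (NatTrans.congr_app (congrArg Quiver.Hom.unop hp) a) h).symm⟩
  · rintro ⟨hfaith, hfull⟩
    refine ⟨⟨fun {b b'} T => ?_⟩, ⟨fun {b b'} p q hpq => hfaith p q fun a h => ?_⟩⟩
    · obtain ⟨p, hp⟩ := hfull (fun a h => T.unop.app a h)
        (fun a a' f h => NatTrans.naturality_apply T.unop f h)
      refine ⟨p, Quiver.Hom.unop_inj (NatTrans.ext (funext fun a => ?_))⟩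
      ext h
      exact (hp a h).symm
    · exact ConcreteCategory.congr_hom
        (NatTrans.congr_app (congrArg Quiver.Hom.unop hpq) a) h

variable {C : Type u} [Category.{w} C]

/-- The family `τ`, restricted to the objects `F a` and transported along `e`, is induced by some
`p` by density of `J`. Maps from the `G (F a)` are jointly epimorphic, and they factor through `G`
by fullness, so naturality of `τ` forces `p` to induce all of `τ`. -/
theorem IsDense.of_precomp (F : A ⥤ B) (G : B ⥤ C) [G.Full] {J : A ⥤ C} (e : J ≅ F ⋙ G)
    (hJ : IsDense J) : IsDense G := by
  obtain ⟨hfaith, hfull⟩ := (isDense_iff J).1 hJ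
  have hcancel : ∀ ⦃c c' : C⦄ (p q : c ⟶ c'),
      (∀ (a : A) (h : G.obj (F.obj a) ⟶ c), h ≫ p = h ≫ q) → p = q := fun c c' p q hpq =>
    hfaith p q fun a h => by
      rw [← cancel_epi (e.inv.app a)]
      simpa using hpq a (e.inv.app a ≫ h)
  refine (isDense_iff G).2 ⟨fun c c' p q hpq => hcancel p q fun a h => hpq _ h, fun c c' τ hτ => ?_⟩
  obtain ⟨p, hp⟩ := hfull (fun a h => e.hom.app a ≫ τ (F.obj a) (e.inv.app a ≫ h))
    (fun a a' f h => by
      have h1 := e.inv.naturality f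
      have h2 := e.hom.naturality f
      simp only [Functor.comp_map] at h1 h2
      rw [← Category.assoc (e.inv.app a'), ← h1, Category.assoc, hτ, ← Category.assoc, ← h2,
        Category.assoc])
  have hp' : ∀ (a : A) (h : G.obj (F.obj a) ⟶ c), τ (F.obj a) h = h ≫ p := fun a h => by
    have := hp a (e.hom.app a ≫ h)
    rw [← cancel_epi (e.hom.app a)]
    simpa using this
  refine ⟨p, fun b h => hcancel _ _ fun a z => ?_⟩
  obtain ⟨g, rfl⟩ := G.map_surjective z
  rw [← hτ, hp', Category.assoc]

theorem IsCodense.of_precomp (F : A ⥤ B) (G : B ⥤ C) [G.Full] {J : A ⥤ C} (e : J ≅ F ⋙ G)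
    (hJ : IsCodense J) : IsCodense G := by
  obtain ⟨hfaith, hfull⟩ := (isCodense_iff J).1 hJ
  have hcancel : ∀ ⦃c c' : C⦄ (p q : c ⟶ c'),
      (∀ (a : A) (h : c' ⟶ G.obj (F.obj a)), p ≫ h = q ≫ h) → p = q := fun c c' p q hpq =>
    hfaith p q fun a h => by
      rw [← cancel_mono (e.hom.app a)]
      simpa using hpq a (h ≫ e.hom.app a)
  refine (isCodense_iff G).2
    ⟨fun c c' p q hpq => hcancel p q fun a h => hpq _ h, fun c c' τ hτ => ?_⟩
  obtain ⟨p, hp⟩ := hfull (fun a h => τ (F.obj a) (h ≫ e.hom.app a) ≫ e.inv.app a)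
    (fun a a' f h => by
      have h1 := e.inv.naturality f
      have h2 := e.hom.naturality f
      simp only [Functor.comp_map] at h1 h2
      rw [Category.assoc, h2, ← Category.assoc, hτ, Category.assoc, h1, Category.assoc])
  have hp' : ∀ (a : A) (h : c' ⟶ G.obj (F.obj a)), τ (F.obj a) h = p ≫ h := fun a h => by
    have := hp a (h ≫ e.inv.app a)
    rw [← cancel_mono (e.inv.app a)]
    simpa using this
  refine ⟨p, fun b h => hcancel _ _ fun a z => ?_⟩
  obtain ⟨g, rfl⟩ := G.map_surjective z
  rw [← hτ, hp', Category.assoc]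

end Density

/-! ### Smallness under change of universe and isomorphism. -/

section Smallness

variable {A : Type u} [Category.{w} A]

/-- Postcomposition with `uliftFunctor` preserves colimits and sends representables to
representables, so the same diagram in `A` still works. -/
theorem IsSmallContra.of_ulift_iso {X : Aᵒᵖ ⥤ Type (max t w)} (hX : IsSmallContra.{t} X)
    {X' : Aᵒᵖ ⥤ Type (max u t w)} (i : X ⋙ uliftFunctor.{u} ≅ X') :
    IsSmallContra.{max u t} X' := by
  obtain ⟨I, hI, D, α, ⟨hc⟩⟩ := hX
  let W := (Functor.whiskeringRight Aᵒᵖ (Type (max t w)) (Type (max u t w))).obj uliftFunctor.{u}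
  let j : D ⋙ uliftYoneda.{max u t} ≅ (D ⋙ uliftYoneda.{t}) ⋙ W :=
    NatIso.ofComponents (fun k => NatIso.ofComponents (fun a =>
      { hom := ↾fun f => ULift.up (ULift.up f.down)
        inv := ↾fun f => ULift.up f.down.down }))
  let c := (Cocone.precompose j.hom).obj (W.mapCocone (Cocone.mk X α))
  have hc' : IsColimit c :=
    (IsColimit.precomposeHomEquiv j _).symm (isColimitOfPreserves W hc)
  exact ⟨I, hI, D, c.ι ≫ (Functor.const I).map i.hom,
    ⟨hc'.ofIsoColimit (Cocone.ext i (fun _ => rfl))⟩⟩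

theorem IsSmallCov.of_ulift_iso {Y : A ⥤ Type (max t w)} (hY : IsSmallCov.{t} Y)
    {Y' : A ⥤ Type (max u t w)} (i : Y ⋙ uliftFunctor.{u} ≅ Y') :
    IsSmallCov.{max u t} Y' := by
  obtain ⟨I, hI, D, α, ⟨hc⟩⟩ := hY
  let W := (Functor.whiskeringRight A (Type (max t w)) (Type (max u t w))).obj uliftFunctor.{u}
  let j : D ⋙ uliftCoyoneda.{max u t} ≅ (D ⋙ uliftCoyoneda.{t}) ⋙ W :=
    NatIso.ofComponents (fun k => NatIso.ofComponents (fun a =>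
      { hom := ↾fun f => ULift.up (ULift.up f.down)
        inv := ↾fun f => ULift.up f.down.down }))
  let c := (Cocone.precompose j.hom).obj (W.mapCocone (Cocone.mk Y α))
  have hc' : IsColimit c :=
    (IsColimit.precomposeHomEquiv j _).symm (isColimitOfPreserves W hc)
  exact ⟨I, hI, D, c.ι ≫ (Functor.const I).map i.hom,
    ⟨hc'.ofIsoColimit (Cocone.ext i (fun _ => rfl))⟩⟩

theorem IsSmallCov.of_iso {Y Y' : A ⥤ Type (max t w)} (hY : IsSmallCov.{t} Y) (i : Y ≅ Y') :
    IsSmallCov.{t} Y' := by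
  obtain ⟨I, hI, D, α, ⟨hc⟩⟩ := hY
  exact ⟨I, hI, D, α ≫ (Functor.const I).map i.hom,
    ⟨hc.ofIsoColimit (Cocone.ext i (fun _ => rfl))⟩⟩

end Smallness

/-! ### The Yoneda embedding into the reflexive completion is small-adequate. -/

section YonedaRefl

variable {A : Type u} [Category.{w} A]

/-- The morphism `A(-, a) ⟶ X` in the reflexive completion corresponding to `x ∈ X(a)`. -/
def elemHom (X : Refl.{t} A) {a : A} (x : X.obj.obj (op a)) : (yonedaRefl.{t} A).obj a ⟶ X :=
  ObjectProperty.homMk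
    { app := fun c => ↾fun f => X.obj.map (Quiver.Hom.op f.down) x
      naturality := fun c c' g => by
        ext f
        exact ConcreteCategory.congr_hom (X.obj.map_comp (Quiver.Hom.op f.down) g) x }

theorem elemHom_app_id (X : Refl.{t} A) {a : A} (x : X.obj.obj (op a)) :
    (elemHom X x).hom.app (op a) (ULift.up (𝟙 a)) = x :=
  ConcreteCategory.congr_hom (X.obj.map_id (op a)) x

theorem yonedaRefl_hom_app {X : Refl.{t} A} {a c : A} (m : (yonedaRefl.{t} A).obj a ⟶ X)
    (f : c ⟶ a) :
    m.hom.app (op c) (ULift.up f) = X.obj.map f.op (m.hom.app (op a) (ULift.up (𝟙 a))) := by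
  refine Eq.trans ?_ (NatTrans.naturality_apply m.hom f.op
    (show (uliftYoneda.{t}.obj a).obj (op a) from ULift.up (𝟙 a)))
  exact congrArg (fun z => m.hom.app (op c) (ULift.up z)) (Category.comp_id f).symm

theorem elemHom_of_hom {X : Refl.{t} A} {a : A} (m : (yonedaRefl.{t} A).obj a ⟶ X) :
    elemHom X (m.hom.app (op a) (ULift.up (𝟙 a))) = m := by
  refine ObjectProperty.hom_ext _ (NatTrans.ext (funext fun c => ?_))
  ext ⟨f⟩
  exact (yonedaRefl_hom_app m f).symm

theorem elemHom_comp {X Y : Refl.{t} A} (m : X ⟶ Y) {a : A} (x : X.obj.obj (op a)) :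
    elemHom X x ≫ m = elemHom Y (m.hom.app (op a) x) := by
  rw [← elemHom_of_hom (elemHom X x ≫ m)]
  exact congrArg (fun z => elemHom Y (m.hom.app (op a) z)) (elemHom_app_id X x)

theorem yonedaRefl_map_comp_elemHom (X : Refl.{t} A) {a a' : A} (f : a' ⟶ a)
    (x : X.obj.obj (op a)) :
    (yonedaRefl.{t} A).map f ≫ elemHom X x = elemHom X (X.obj.map f.op x) := by
  rw [← elemHom_of_hom ((yonedaRefl.{t} A).map f ≫ elemHom X x)]
  refine congrArg (elemHom X) ?_
  exact congrArg (fun z => X.obj.map (Quiver.Hom.op z) x) (Category.id_comp f)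

theorem elemHom_injective (X : Refl.{t} A) {a : A} {x y : X.obj.obj (op a)}
    (h : elemHom X x = elemHom X y) : x = y := by
  rw [← elemHom_app_id X x, h, elemHom_app_id]

theorem yonedaRefl_full : (yonedaRefl.{t} A).Full where
  map_surjective {a b} m := by
    refine ⟨(m.hom.app (op a) (ULift.up (𝟙 a))).down, (elemHom_of_hom _).symm.trans
      ((congrArg (elemHom _) ?_).trans (elemHom_of_hom m))⟩
    exact congrArg ULift.up (Category.id_comp _)

theorem yonedaRefl_faithful : (yonedaRefl.{t} A).Faithful where
  map_injective {a b} f g h := by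
    have h' : ULift.up (𝟙 a ≫ f) = ULift.up (𝟙 a ≫ g) := congrArg
      (fun m : (yonedaRefl.{t} A).obj a ⟶ (yonedaRefl.{t} A).obj b =>
        m.hom.app (op a) (ULift.up (𝟙 a))) h
    simpa using h'

theorem isDense_yonedaRefl : IsDense (yonedaRefl.{t} A) := by
  refine (isDense_iff _).2 ⟨fun X Y p q hpq => ?_, fun X Y τ hτ => ?_⟩
  · refine ObjectProperty.hom_ext _ (NatTrans.ext (funext fun a => ?_))
    ext x
    have h := hpq a.unop (elemHom X x)
    rw [elemHom_comp, elemHom_comp] at h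
    exact elemHom_injective Y h
  -- The inducing map sends `x` to the element classified by `τ (elemHom X x)`.
  · refine ⟨ObjectProperty.homMk
      { app := fun a => ↾fun x => (τ a.unop (elemHom X x)).hom.app a (ULift.up (𝟙 a.unop))
        naturality := fun a a' f => by
          ext x
          refine elemHom_injective Y ?_
          refine (elemHom_of_hom _).trans ?_
          refine (congrArg (τ a'.unop) (yonedaRefl_map_comp_elemHom X f.unop x).symm).trans ?_
          refine (hτ a.unop a'.unop f.unop _).trans ?_
          rw [← elemHom_of_hom (τ a.unop (elemHom X x)), yonedaRefl_map_comp_elemHom]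
          rfl }, fun a m => ?_⟩
    rw [← elemHom_of_hom m, elemHom_comp]
    exact (elemHom_of_hom _).symm

theorem toDoubleConj_bijective (X : Refl.{t} A) (a : Aᵒᵖ) :
    Function.Bijective ((toDoubleConj.{t} X.obj).app a) := by
  have := X.property.isIso_toDoubleConj
  exact (isIso_iff_bijective _).1 inferInstance

/-- Injectivity of the double conjugation map. -/
theorem Refl.eq_of_forall_hom (X : Refl.{t} A) {a : Aᵒᵖ} {x y : X.obj.obj a}
    (h : ∀ (c : A) (ξ : X ⟶ (yonedaRefl.{t} A).obj c), ξ.hom.app a x = ξ.hom.app a y) :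
    x = y := by
  refine congrArg ULift.down ((toDoubleConj_bijective X a).1 (a₁ := ULift.up x) (a₂ := ULift.up y)
    (NatTrans.ext (funext fun c => ?_)))
  ext ξ
  exact congrArg (fun z => ULift.up (ULift.down z)) (h c (ObjectProperty.homMk ξ))

/-- Surjectivity of the double conjugation map: the natural family `τ` is an element of the double
conjugate at `a`. -/
theorem Refl.exists_of_natural (X : Refl.{t} A) (a : Aᵒᵖ)
    (τ : ∀ c : A, (X ⟶ (yonedaRefl.{t} A).obj c) → (a.unop ⟶ c))
    (hτ : ∀ (c c' : A) (f : c ⟶ c') (ξ : X ⟶ (yonedaRefl.{t} A).obj c),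
      τ c' (ξ ≫ (yonedaRefl.{t} A).map f) = τ c ξ ≫ f) :
    ∃ x : X.obj.obj a, ∀ (c : A) (ξ : X ⟶ (yonedaRefl.{t} A).obj c),
      ξ.hom.app a x = ULift.up (τ c ξ) := by
  let T : (conjCov.{max u t} (conjContra.{t} X.obj)).obj a :=
    show conjContra.{t} X.obj ⟶ uliftCoyoneda.{max u t}.obj a from
    { app := fun c => ↾fun ξ => ULift.up (τ c (ObjectProperty.homMk ξ))
      naturality := fun c c' f => by
        ext ξ
        exact congrArg ULift.up (hτ c c' f (ObjectProperty.homMk ξ)) }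
  obtain ⟨⟨x⟩, hx⟩ := (toDoubleConj_bijective X a).2 T
  refine ⟨x, fun c ξ => ?_⟩
  exact congrArg (fun z : ULift.{max u t} (a.unop ⟶ c) => (ULift.up z.down : ULift.{t} _))
    (ConcreteCategory.congr_hom (NatTrans.congr_app hx c) ξ.hom)

theorem isCodense_yonedaRefl : IsCodense (yonedaRefl.{t} A) := by
  refine (isCodense_iff _).2 ⟨fun X Y p q hpq => ?_, fun X Y τ hτ => ?_⟩
  · refine ObjectProperty.hom_ext _ (NatTrans.ext (funext fun a => ?_))
    ext x
    refine Y.eq_of_forall_hom fun c ξ => ?_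
    exact congrArg (fun m : X ⟶ (yonedaRefl.{t} A).obj c => m.hom.app a x) (hpq c ξ)
  -- Evaluating each `τ c ξ` at `x` gives an element of the double conjugate of `Y`, hence an
  -- element of `Y`.
  · have key : ∀ (a : Aᵒᵖ) (x : X.obj.obj a), ∃ y : Y.obj.obj a,
        ∀ (c : A) (ξ : Y ⟶ (yonedaRefl.{t} A).obj c),
          ξ.hom.app a y = (τ c ξ).hom.app a x := fun a x => by
      refine Y.exists_of_natural a (fun c ξ => ((τ c ξ).hom.app a x).down) fun c c' f ξ => ?_
      rw [hτ]
      rfl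
    choose p hp using key
    refine ⟨ObjectProperty.homMk
      { app := fun a => ↾fun x => p a x
        naturality := fun a a' f => by
          ext x
          refine Y.eq_of_forall_hom fun c ξ => ?_
          refine (hp a' _ c ξ).trans ?_
          refine (NatTrans.naturality_apply (τ c ξ).hom f x).trans ?_
          refine Eq.trans ?_ (NatTrans.naturality_apply ξ.hom f (p a x)).symm
          rw [hp] }, fun c ξ => ?_⟩
    refine ObjectProperty.hom_ext _ (NatTrans.ext (funext fun a => ?_))
    ext x
    exact (hp a x c ξ).symm

theorem isSmallAdequate_yonedaRefl : IsSmallAdequate.{max u t} (yonedaRefl.{t} A) where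
  full := yonedaRefl_full
  faithful := yonedaRefl_faithful
  dense := isDense_yonedaRefl
  codense := isCodense_yonedaRefl
  small X := X.property.small.of_ulift_iso (NatIso.ofComponents
    (fun a =>
      { hom := ↾fun x => elemHom X (a := a.unop) x.down
        inv := ↾fun m => ULift.up (m.hom.app a (ULift.up (𝟙 a.unop)))
        hom_inv_id := by
          ext ⟨x⟩
          exact congrArg ULift.up (elemHom_app_id X x)
        inv_hom_id := by
          ext m
          exact elemHom_of_hom m })
    (fun {a a'} f => by
      ext ⟨x⟩
      exact (yonedaRefl_map_comp_elemHom X f.unop x).symm))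
  cosmall X := X.property.conj_small.of_iso (NatIso.ofComponents
    (fun a =>
      { hom := ↾fun ξ => ObjectProperty.homMk ξ
        inv := ↾fun m => m.hom })
    (fun f => rfl))

end YonedaRefl

/-! ### The nerve of a small-adequate functor and its universal property. -/

section Extension

variable {A : Type u₁} [Category.{w} A] {B : Type u₂} [Category.{max t w} B]

/-- The transformation `B(F -, b) ⟶ A(-, c)` induced by `g : b ⟶ F c`, for `F` full and
faithful. -/
noncomputable def nerveHom (F : A ⥤ B) [F.Full] [F.Faithful] {b : B} {c : A} (g : b ⟶ F.obj c) :
    (relNerve F).obj b ⟶ uliftYoneda.{t}.obj c where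
  app a := ↾fun h => ULift.up (F.preimage (show F.obj a.unop ⟶ F.obj c from h ≫ g))
  naturality a a' f := by
    ext h
    refine congrArg ULift.up (F.map_injective ?_)
    refine (F.map_preimage _).trans (Eq.trans ?_ (F.map_comp _ _).symm)
    exact (Category.assoc _ _ _).trans (congrArg (F.map f.unop ≫ ·) (F.map_preimage _).symm)

theorem map_nerveHom_app (F : A ⥤ B) [F.Full] [F.Faithful] {b : B} {c : A} (g : b ⟶ F.obj c)
    {a : A} (h : F.obj a ⟶ b) :
    F.map ((nerveHom.{t} F g).app (op a) h).down = h ≫ g :=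
  F.map_preimage _

/-- Composing `ξ` with the action of `F` gives a natural map `B(F -, b) ⟶ B(F -, F c)`, which
density represents by some `g`. -/
theorem exists_nerveHom {F : A ⥤ B} [F.Full] [F.Faithful] (hF : IsDense F) {b : B} {c : A}
    (ξ : (relNerve F).obj b ⟶ uliftYoneda.{t}.obj c) : ∃ g, nerveHom.{t} F g = ξ := by
  obtain ⟨g, hg⟩ := ((isDense_iff F).1 hF).2
    (fun (a : A) (h : F.obj a ⟶ b) => F.map (ξ.app (op a) h).down)
    (fun a a' f h => by
      rw [← F.map_comp]
      refine congrArg (fun z => F.map (ULift.down z)) ?_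
      exact NatTrans.naturality_apply ξ f.op h)
  refine ⟨g, NatTrans.ext (funext fun a => ?_)⟩
  ext h
  refine congrArg ULift.up (F.map_injective ?_)
  exact (map_nerveHom_app F g h).trans (hg a.unop h).symm

theorem nerveHom_injective {F : A ⥤ B} [F.Full] [F.Faithful] (hF : IsDense F) {b : B} {c : A} :
    Function.Injective (nerveHom.{t} F : (b ⟶ F.obj c) → _) := fun g g' hg =>
  ((isDense_iff F).1 hF).1 g g' fun a h => by
    rw [← map_nerveHom_app, ← map_nerveHom_app, hg]

theorem nerveHom_comp (F : A ⥤ B) [F.Full] [F.Faithful] {b : B} {c c' : A} (g : b ⟶ F.obj c)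
    (f : c ⟶ c') :
    nerveHom.{t} F (g ≫ F.map f) = nerveHom.{t} F g ≫ uliftYoneda.{t}.map f := by
  refine NatTrans.ext (funext fun a => ?_)
  ext h
  refine congrArg ULift.up (F.map_injective ?_)
  refine (map_nerveHom_app F _ h).trans (Eq.trans ?_ (F.map_comp _ _).symm)
  exact (Category.assoc _ _ _).symm.trans
    (congrArg (· ≫ F.map f) (map_nerveHom_app F g h).symm)

/-- For `F` full, faithful and dense, the conjugate of `B(F -, b)` is `B(b, F -)`. -/
noncomputable def conjNerveIso {F : A ⥤ B} [F.Full] [F.Faithful] (hF : IsDense F) (b : B) :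
    ((relConerve F).obj b).unop ⋙ uliftFunctor.{u₁} ≅ conjContra.{t} ((relNerve F).obj b) :=
  NatIso.ofComponents
    (fun c => (Equiv.ulift.trans (Equiv.ofBijective (nerveHom.{t} F : (b ⟶ F.obj c) → _)
      ⟨nerveHom_injective hF, exists_nerveHom hF⟩)).toIso)
    (fun {c c'} f => by
      ext ⟨g⟩
      exact nerveHom_comp F g f)

/-- Once the conjugate is identified with `B(b, F -)`, the double conjugation map sends `x : F a ⟶
b` to precomposition with `x`. The two halves of codensity give its injectivity and surjectivity. -/
theorem IsSmallAdequate.isReflexive {F : A ⥤ B} (hF : IsSmallAdequate.{t} F) (b : B) :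
    IsReflexive.{t} ((relNerve F).obj b) := by
  have := hF.full
  have := hF.faithful
  obtain ⟨hinj, hsurj⟩ := (isCodense_iff F).1 hF.codense
  refine ⟨hF.small b, (hF.cosmall b).of_ulift_iso (conjNerveIso hF.dense b), ?_⟩
  rw [NatTrans.isIso_iff_isIso_app]
  intro a
  rw [isIso_iff_bijective]
  constructor
  · rintro ⟨x⟩ ⟨y⟩ hxy
    refine congrArg ULift.up (hinj _ _ fun c g => ?_)
    have h : (nerveHom.{t} F g).app a x = (nerveHom.{t} F g).app a y :=
      congrArg (fun z : ULift.{max u₁ t} (a.unop ⟶ c) => (ULift.up z.down : ULift.{t} _))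
        (ConcreteCategory.congr_hom (NatTrans.congr_app hxy c) (nerveHom.{t} F g))
    exact (map_nerveHom_app F g x).symm.trans
      ((congrArg (fun z => F.map (ULift.down z)) h).trans (map_nerveHom_app F g y))
  · intro τ
    let T : conjContra.{t} ((relNerve F).obj b) ⟶ uliftCoyoneda.{max u₁ t}.obj a := τ
    obtain ⟨x, hx⟩ := hsurj (b := F.obj a.unop) (b' := b)
      (fun c g => F.map (T.app c (nerveHom.{t} F g)).down)
      (fun c c' f g => by
        rw [← F.map_comp, nerveHom_comp]
        exact congrArg (fun z => F.map (ULift.down z))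
          (NatTrans.naturality_apply T f (nerveHom.{t} F g)))
    refine ⟨ULift.up x, NatTrans.ext (funext fun c => ?_)⟩
    ext ξ
    obtain ⟨g, rfl⟩ := exists_nerveHom hF.dense ξ
    refine congrArg ULift.up (F.map_injective ?_)
    exact (map_nerveHom_app F g x).trans (hx c g).symm

variable {F : A ⥤ B} (hN : ∀ b : B, IsReflexive.{t} ((relNerve F).obj b))

/-- The canonical isomorphism between `A(-, a)` and `B(F -, F a)`. -/
noncomputable def yonedaReflIso [F.Full] [F.Faithful] :
    yonedaRefl.{t} A ≅ F ⋙ reflNerve.{t} F hN :=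
  NatIso.ofComponents
    (fun a => ObjectProperty.isoMk _ (NatIso.ofComponents
      (fun a' => (Equiv.ulift.trans
        (Equiv.ofBijective (F.map : (a'.unop ⟶ a) → _)
          ((Functor.FullyFaithful.ofFullyFaithful F).map_bijective _ _))).toIso)
      (fun {a' a''} f => by
        ext ⟨g⟩
        exact F.map_comp f.unop g)))
    (fun {a b} f => by
      refine ObjectProperty.hom_ext _ (NatTrans.ext (funext fun a' => ?_))
      ext ⟨g⟩
      exact F.map_comp g f)

theorem isAdequate_reflNerve [F.Full] [F.Faithful] (hF : IsDense F) :
    IsAdequate (reflNerve.{t} F hN) := by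
  have hfull : (reflNerve.{t} F hN).Full := ⟨fun {b b'} m => by
    obtain ⟨p, hp⟩ := hF.1.map_surjective m.hom
    exact ⟨p, ObjectProperty.hom_ext _ hp⟩⟩
  have hfaith : (reflNerve.{t} F hN).Faithful := ⟨fun {b b'} p q h =>
    hF.2.map_injective (congrArg (fun m => m.hom) h)⟩
  exact ⟨hfull, hfaith, isDense_yonedaRefl.of_precomp F _ (yonedaReflIso hN),
    isCodense_yonedaRefl.of_precomp F _ (yonedaReflIso hN)⟩

variable {G : B ⥤ Refl.{t} A} (φ : yonedaRefl.{t} A ≅ F ⋙ G)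

/-- The element of `G(b)(a)` classified by `h : F a ⟶ b`. -/
def elemOfHom {b : B} {a : A} (h : F.obj a ⟶ b) : (G.obj b).obj.obj (op a) :=
  (φ.hom.app a ≫ G.map h).hom.app (op a) (ULift.up (𝟙 a))

theorem elemHom_elemOfHom {b : B} {a : A} (h : F.obj a ⟶ b) :
    elemHom (G.obj b) (elemOfHom φ h) = φ.hom.app a ≫ G.map h :=
  elemHom_of_hom _

theorem elemOfHom_bijective [G.Full] [G.Faithful] (b : B) (a : A) :
    Function.Bijective (elemOfHom φ : (F.obj a ⟶ b) → _) := by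
  constructor
  · intro h h' hh
    have := congrArg (elemHom (G.obj b)) hh
    rw [elemHom_elemOfHom, elemHom_elemOfHom, cancel_epi] at this
    exact G.map_injective this
  · intro x
    obtain ⟨h, hh⟩ := G.map_surjective (φ.inv.app a ≫ elemHom (G.obj b) x)
    refine ⟨h, elemHom_injective _ ?_⟩
    rw [elemHom_elemOfHom, hh]
    simp

theorem elemOfHom_map_comp {b : B} {a a' : A} (f : a' ⟶ a) (h : F.obj a ⟶ b) :
    elemOfHom φ (F.map f ≫ h) = (G.obj b).obj.map f.op (elemOfHom φ h) := by
  refine elemHom_injective _ ?_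
  rw [← yonedaRefl_map_comp_elemHom, elemHom_elemOfHom, elemHom_elemOfHom, G.map_comp]
  have := φ.hom.naturality f
  simp only [Functor.comp_map] at this
  rw [← Category.assoc, ← this, Category.assoc]

theorem elemOfHom_comp {b b' : B} {a : A} (h : F.obj a ⟶ b) (k : b ⟶ b') :
    elemOfHom φ (h ≫ k) = (G.map k).hom.app (op a) (elemOfHom φ h) := by
  refine elemHom_injective _ ?_
  rw [← elemHom_comp, elemHom_elemOfHom, elemHom_elemOfHom, G.map_comp, Category.assoc]

/-- A full and faithful extension of the Yoneda embedding along `F` is isomorphic to the nerve. -/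
noncomputable def nerveIsoExtension [G.Full] [G.Faithful] : reflNerve.{t} F hN ≅ G :=
  NatIso.ofComponents
    (fun b => ObjectProperty.isoMk _ (NatIso.ofComponents
      (fun a => (Equiv.ofBijective (elemOfHom φ : (F.obj a.unop ⟶ b) → _)
        (elemOfHom_bijective φ b a.unop)).toIso)
      (fun {a a'} f => by
        ext h
        exact elemOfHom_map_comp φ f.unop h)))
    (fun {b b'} k => by
      refine ObjectProperty.hom_ext _ (NatTrans.ext (funext fun a => ?_))
      ext h
      exact elemOfHom_comp φ h k)

/-- Both sides have components out of representables, so it suffices to compare them at identities.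
-/
theorem yonedaReflIso_hom_comp_nerveIsoExtension [F.Full] [F.Faithful] [G.Full] [G.Faithful] :
    (yonedaReflIso hN).hom ≫ Functor.whiskerLeft F (nerveIsoExtension hN φ).hom = φ.hom := by
  refine NatTrans.ext (funext fun a => ?_)
  rw [← elemHom_of_hom (φ.hom.app a), ← elemHom_of_hom (NatTrans.app _ a)]
  refine congrArg (elemHom _) ?_
  change elemOfHom φ (F.map (𝟙 a)) = _
  rw [F.map_id]
  refine elemHom_injective _ ?_
  refine (elemHom_elemOfHom φ _).trans ?_
  rw [G.map_id]
  exact (Category.comp_id _).trans (elemHom_of_hom (φ.hom.app a)).symm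

/-- By density of `J`, a component at `b` is determined by precomposing with maps `J a ⟶ G b`. These
factor through `G` applied to maps `F a ⟶ b`, so naturality reduces the claim to the components at
`F a`. -/
theorem extension_hom_ext [G.Full] {H : B ⥤ Refl.{t} A} {θ θ' : G ⟶ H}
    (h : φ.hom ≫ Functor.whiskerLeft F θ = φ.hom ≫ Functor.whiskerLeft F θ') : θ = θ' := by
  rw [cancel_epi] at h
  refine NatTrans.ext (funext fun b => ((isDense_iff _).1 isDense_yonedaRefl).1 _ _ fun a x => ?_)
  obtain ⟨k, hk⟩ := G.map_surjective (φ.inv.app a ≫ x)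
  have hx : x = φ.hom.app a ≫ G.map k := by rw [hk]; simp
  have ha : θ.app (F.obj a) = θ'.app (F.obj a) := NatTrans.congr_app h a
  rw [hx, Category.assoc, Category.assoc, θ.naturality, θ'.naturality, ha]

end Extension

end ReflexiveCompletion

theorem theorem8p4 {A : Type u₁} [Category.{w} A] {B : Type u₂}
    [Category.{max t w} B] (F : A ⥤ B) (hF : IsSmallAdequate.{t} F) :
    -- the Yoneda embedding is itself a small-adequate extension of `A`
    IsSmallAdequate.{max u₁ t} (yonedaRefl.{t} A) ∧
    -- the nerve of `F` takes values in the reflexive completion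
    ∃ hN : ∀ b : B, IsReflexive.{t} ((relNerve F).obj b),
      IsAdequate (reflNerve.{t} F hN) ∧
      -- the triangle commutes up to the canonical isomorphism `A(a', a) ≅ B(F a', F a)`
      ∃ e : yonedaRefl.{t} A ≅ F ⋙ reflNerve.{t} F hN,
        (∀ (a a' : A) (f : a' ⟶ a),
          (e.hom.app a).hom.app (op a') (ULift.up f) = F.map f) ∧
        -- any full and faithful `G` under the triangle is uniquely isomorphic to the nerve
        ∀ G : B ⥤ Refl.{t} A, G.Full → G.Faithful → ∀ φ : yonedaRefl.{t} A ≅ F ⋙ G,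
          ∃ θ : G ≅ reflNerve.{t} F hN,
            φ.hom ≫ Functor.whiskerLeft F θ.hom = e.hom ∧
            ∀ θ' : G ⟶ reflNerve.{t} F hN,
              φ.hom ≫ Functor.whiskerLeft F θ' = e.hom → θ' = θ.hom := by
  have := hF.full
  have := hF.faithful
  refine ⟨isSmallAdequate_yonedaRefl, hF.isReflexive, isAdequate_reflNerve _ hF.dense,
    yonedaReflIso _, fun a a' f => rfl, fun G hG hG' φ => ?_⟩
  have h : φ.hom ≫ Functor.whiskerLeft F (nerveIsoExtension hF.isReflexive φ).symm.hom =
      (yonedaReflIso hF.isReflexive).hom := by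
    rw [← yonedaReflIso_hom_comp_nerveIsoExtension hF.isReflexive φ, Category.assoc,
      ← Functor.whiskerLeft_comp]
    simp
  exact ⟨(nerveIsoExtension hF.isReflexive φ).symm, h,
    fun θ' hθ' => extension_hom_ext φ (hθ'.trans h.symm)⟩
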